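/- Let $\lambda>0$, $\alpha>0$ and $\rho=\lambda\alpha$. Consider the $M|M|\infty$ queue: customers arrive according to a Poisson process of rate $\lambda$ (independent exponential interarrival times with parameter $\lambda$), the service times are exponential with mean $\alpha$, independent of each other and of the arrivals, and there are infinitely many servers, so that every service starts on arrival. The system is empty at time $0$. Let $I$ be the length of the initial idle period (the time until the first customer is present), $B$ the length of the busy period that follows it (the time from the end of the idle period until the system is next empty), and $Z=I+B$ the length of the busy cycle. Then for every $t\ge 0$: (i) if $2\rho\neq 1$, then $$P(Z\le t)\;\ge\;1-\frac{(\rho-1)e^{-\lambda t}+\rho\,e^{-\frac{1-\rho}{\alpha}t}}{2\rho-1};$$ (ii) if $\rho(1+e^{-\rho})\neq 1$, then $$P(Z\le t)\;\le\;1-\frac{(\rho-1)e^{-\lambda t}+\rho\,e^{-\rho-\frac{1-\rho e^{-\rho}}{\alpha}t}}{\rho(1+e^{-\rho})-1}.$$ -/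

import Mathlib

open MeasureTheory ProbabilityTheory

namespace MMInfQueue

/-- `A` and `S` are the interarrival times and the service times of an `M|M|∞` queue that is empty
at time `0`, with Poisson arrivals of rate `lam` and exponential service times of mean `α`:
all interarrival times `A 0, A 1, …` and all service times `S 0, S 1, …` are mutually independent,
the former exponential with rate `lam`, the latter exponential with rate `α⁻¹`.
The first customer arrives at time `A 0`. -/
structure IsQueue {Ω : Type*} [MeasurableSpace Ω] (P : Measure Ω) (lam α : ℝ)
    (A S : ℕ → Ω → ℝ) : Prop where
  hasLaw_interarrival : ∀ n, HasLaw (A n) (expMeasure lam) P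
  hasLaw_service : ∀ n, HasLaw (S n) (expMeasure α⁻¹) P
  indep : iIndepFun (Sum.elim A S) P

/-- The arrival instant of customer `n` (the customers are numbered from `0`). -/
def arrivalTime (a : ℕ → ℝ) (n : ℕ) : ℝ := ∑ i ∈ Finset.range (n + 1), a i

/-- The customers present at time `t`. With infinitely many servers, the service of every customer
starts on arrival, so customer `n` is present from `arrivalTime a n` (included) to
`arrivalTime a n + s n` (excluded). -/
def present (a s : ℕ → ℝ) (t : ℝ) : Set ℕ :=
  {n | arrivalTime a n ≤ t ∧ t < arrivalTime a n + s n}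

/-- The number of customers in the system (that is, of busy servers) at time `t`. -/
noncomputable def numInSystem (a s : ℕ → ℝ) (t : ℝ) : ℕ∞ := (present a s t).encard

/-- The length of the initial idle period: the first time at which the system is not empty. -/
noncomputable def idlePeriod (a s : ℕ → ℝ) : ℝ :=
  sInf {t : ℝ | 0 ≤ t ∧ numInSystem a s t ≠ 0}

/-- The length of the busy period that follows the initial idle period: the time that elapses from
the end of the idle period until the system is empty (`⊤` if this never happens). -/
noncomputable def busyPeriod (a s : ℕ → ℝ) : EReal :=
  ⨅ u ∈ {u : ℝ | 0 ≤ u ∧ numInSystem a s (idlePeriod a s + u) = 0}, (u : EReal)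

/-- The length of the busy cycle: an idle period followed by a busy period. -/
noncomputable def busyCycle (a s : ℕ → ℝ) : EReal := (idlePeriod a s : EReal) + busyPeriod a s

end MMInfQueue

/-! Let p(t) = P(Z > t). Almost surely Z > t means that nobody has arrived by t, or that some
customer of the first busy period is present at t. Such a customer n is recognised by `Connected`,
which involves only the interarrival times up to n and the service times before n, and so is
independent of the service of n.

By the constant hazard rate of the exponential law, the arrivals inside the first busy cycle have
intensity λ p(u) at time u (`IsQueueLaw.tsum_lintegral_connected`). Hence the expected number of
them present at t is N(t) = ∫₀ᵗ λ e^{-(t-u)/α} p(u) du.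

The union bound gives p(t) ≤ e^{-λt} + N(t) (`IsQueueLaw.measure_unfinished_le`). For a lower bound,
count only the last of these customers: the corresponding events are disjoint, and the customers
after n behave as a queue started empty, which is empty at any given later time with probability at
least e^{-ρ} (`IsQueueLaw.emptyProb_le`). So p(t) ≥ e^{-λt} + e^{-ρ} N(t)
(`IsQueueLaw.le_measure_unfinished`).

With a factor q before the integral, the equation y = e^{-λt} + q ∫₀ᵗ λ e^{-(t-u)/α} y(u) du has the
explicit solution `tailBound`. A Grönwall comparison with q = 1 and q = e^{-ρ} gives the two bounds.
-/

namespace MMInfQueue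
open Set Filter Topology
open scoped ENNReal

/-! ### Integrating out independent blocks of coordinates -/

section Independence

variable {ι : Type*}

/-- Functions of disjoint finite blocks of independent coordinates can be integrated one block at a
time. -/
lemma lintegral_decouple {Q : Measure (ι → ℝ)} [IsProbabilityMeasure Q]
    (h : iIndepFun (fun i (x : ι → ℝ) ↦ x i) Q) {I J : Finset ι} (hIJ : Disjoint I J)
    {Φ : (ι → ℝ) → (ι → ℝ) → ℝ≥0∞} (hΦ : Measurable (Function.uncurry Φ))
    (hI : ∀ y, DependsOn (fun x ↦ Φ x y) (I : Set ι)) (hJ : ∀ x, DependsOn (Φ x) (J : Set ι)) :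
    ∫⁻ x, Φ x x ∂Q = ∫⁻ x, ∫⁻ y, Φ x y ∂Q ∂Q := by
  classical
  -- The value 0 off `K` is arbitrary: `Φ` does not see those coordinates. Filling them in turns `Φ
  -- x y` into a function of the two independent finite restrictions.
  let ext (K : Finset ι) (z : K → ℝ) (i : ι) : ℝ := if hi : i ∈ K then z ⟨i, hi⟩ else 0
  have hext (K : Finset ι) : Measurable (ext K) := by
    refine measurable_pi_lambda _ fun i ↦ ?_
    by_cases hi : i ∈ K
    · simpa [ext, hi] using measurable_pi_apply _
    · simp [ext, hi]
  let res (K : Finset ι) (x : ι → ℝ) : ι → ℝ := ext K fun i ↦ x i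
  have hres (K : Finset ι) : Measurable (res K) :=
    (hext K).comp (measurable_pi_lambda (fun (x : ι → ℝ) (i : K) ↦ x i) fun i ↦ measurable_pi_apply _)
  have hΦres (x y : ι → ℝ) : Φ (res I x) (res J y) = Φ x y := by
    rw [hJ _ (fun i hi ↦ ?_ : ∀ i ∈ (J : Set ι), res J y i = y i)]
    · exact hI y fun i hi ↦ by simp_all [res, ext]
    · simp_all [res, ext]
  have hind : IndepFun (res I) (res J) Q :=
    (h.indepFun_finset I J hIJ fun i ↦ measurable_pi_apply i).comp (hext I) (hext J)
  have hprod := hind.map_prod_eq_prod_map_map (hres I).aemeasurable (hres J).aemeasurable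
  have : IsProbabilityMeasure (Q.map (res J)) :=
    Measure.isProbabilityMeasure_map (hres J).aemeasurable
  calc ∫⁻ x, Φ x x ∂Q = ∫⁻ x, Function.uncurry Φ (res I x, res J x) ∂Q := by
        simp [Function.uncurry, hΦres]
    _ = ∫⁻ p, Function.uncurry Φ p ∂(Q.map (res I)).prod (Q.map (res J)) := by
        rw [← hprod, lintegral_map hΦ ((hres I).prodMk (hres J))]
    _ = ∫⁻ x, ∫⁻ y, Φ (res I x) (res J y) ∂Q ∂Q := by
        rw [lintegral_prod _ hΦ.aemeasurable, lintegral_map _ (hres I)]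
        · refine lintegral_congr fun x ↦ ?_
          exact lintegral_map (hΦ.comp measurable_prodMk_left) (hres J)
        · exact hΦ.lintegral_prod_right'
    _ = _ := by simp [hΦres]

/-- The version of `lintegral_decouple` for events. -/
lemma measure_decouple {Q : Measure (ι → ℝ)} [IsProbabilityMeasure Q]
    (h : iIndepFun (fun i (x : ι → ℝ) ↦ x i) Q) {I J : Finset ι} (hIJ : Disjoint I J)
    {R : (ι → ℝ) → (ι → ℝ) → Prop}
    (hR : MeasurableSet {p : (ι → ℝ) × (ι → ℝ) | R p.1 p.2})
    (hI : ∀ y, DependsOn (fun x ↦ R x y) (I : Set ι)) (hJ : ∀ x, DependsOn (R x) (J : Set ι)) :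
    Q {x | R x x} = ∫⁻ x, Q {y | R x y} ∂Q := by
  classical
  have key := lintegral_decouple h hIJ (Φ := fun x y ↦ if R x y then 1 else 0)
    (Measurable.ite hR measurable_const measurable_const)
    (fun y x x' hx ↦ by simp only [hI y hx]) (fun x y y' hy ↦ by simp only [hJ x hy])
  have hd : MeasurableSet {x | R x x} := hR.preimage (measurable_id.prodMk measurable_id)
  have h1 : ∫⁻ x, (if R x x then 1 else 0) ∂Q = Q {x | R x x} := by
    rw [← lintegral_indicator_one hd]; rfl
  have h2 (x : ι → ℝ) : ∫⁻ y, (if R x y then 1 else 0) ∂Q = Q {y | R x y} := by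
    have hx : MeasurableSet {y | R x y} := hR.preimage measurable_prodMk_left
    rw [← lintegral_indicator_one hx]; rfl
  rw [← h1, key]
  exact lintegral_congr h2

end Independence

/-! ### The exponential law and its hazard rate -/

section Exponential

lemma expMeasure_Ioi {r v : ℝ} (hr : 0 < r) (hv : 0 ≤ v) :
    expMeasure r (Ioi v) = ENNReal.ofReal (Real.exp (-(r * v))) := by
  have := isProbabilityMeasure_expMeasure hr
  rw [← compl_Iic, prob_compl_eq_one_sub measurableSet_Iic, ← ofReal_cdf, cdf_expMeasure_eq hr,
    if_pos hv, ← ENNReal.ofReal_one, ← ENNReal.ofReal_sub]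
  · simp
  · simpa using mul_nonneg hr.le hv

lemma expMeasure_Iic {r v : ℝ} (hr : 0 < r) (hv : 0 ≤ v) :
    expMeasure r (Iic v) = ENNReal.ofReal (1 - Real.exp (-(r * v))) := by
  have := isProbabilityMeasure_expMeasure hr
  rw [← ofReal_cdf, cdf_expMeasure_eq hr, if_pos hv]

lemma expMeasure_Iic_zero {r : ℝ} (hr : 0 < r) : expMeasure r (Iic 0) = 0 := by
  simp [expMeasure_Iic hr le_rfl]

lemma lintegral_expMeasure {r : ℝ} (f : ℝ → ℝ≥0∞) (hf : Measurable f) :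
    ∫⁻ a, f a ∂expMeasure r = ∫⁻ a, exponentialPDF r a * f a := by
  have hm : Measurable (exponentialPDF r) := (measurable_exponentialPDFReal r).ennreal_ofReal
  exact lintegral_withDensity_eq_lintegral_mul _ hm hf

/-- The hazard rate of the exponential distribution is constant. -/
lemma lintegral_expMeasure_add {r : ℝ} (hr : 0 < r) (τ : ℝ) (f : ℝ → ℝ≥0∞) (hf : Measurable f) :
    ∫⁻ a, f (τ + a) ∂expMeasure r
      = ∫⁻ u, ENNReal.ofReal r * f u * expMeasure r {a | τ ≤ u ∧ u < τ + a} := by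
  -- After the translation u = τ + a, the claim is the pointwise identity density = r · tail for a ≥
  -- 0; both sides vanish for a < 0.
  rw [lintegral_expMeasure _ (by fun_prop),
    ← lintegral_add_left_eq_self (μ := volume)
      (fun u ↦ ENNReal.ofReal r * f u * expMeasure r {a | τ ≤ u ∧ u < τ + a}) τ]
  refine lintegral_congr fun a ↦ ?_
  rcases lt_or_ge a 0 with ha | ha
  · simp [exponentialPDF_of_neg ha, ha.not_ge]
  · have : {b : ℝ | τ ≤ τ + a ∧ τ + a < τ + b} = Ioi a := by ext b; simp [ha]
    rw [exponentialPDF_of_nonneg ha, this, expMeasure_Ioi hr ha, ENNReal.ofReal_mul hr.le]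
    ring

end Exponential

/-! ### Deterministic description of the busy cycle along a path -/

section Paths

variable {a s : ℕ → ℝ}

@[simp] lemma arrivalTime_zero : arrivalTime a 0 = a 0 := by simp [arrivalTime]

lemma arrivalTime_succ (n : ℕ) : arrivalTime a (n + 1) = arrivalTime a n + a (n + 1) := by
  simp [arrivalTime, Finset.sum_range_succ]

lemma arrivalTime_strictMono (ha : ∀ n, 0 < a n) : StrictMono (arrivalTime a) :=
  strictMono_nat_of_lt_succ fun n ↦ by rw [arrivalTime_succ]; linarith [ha (n + 1)]

lemma arrivalTime_congr {a' : ℕ → ℝ} {n : ℕ} (h : ∀ i ≤ n, a i = a' i) :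
    arrivalTime a n = arrivalTime a' n :=
  Finset.sum_congr rfl fun i hi ↦ h i (by simpa [Nat.lt_succ_iff] using hi)

/-- Each of the customers `1, …, n` arrives not later than one of the previous ones leaves. -/
def Connected (a s : ℕ → ℝ) (n : ℕ) : Prop :=
  ∀ k < n, ∃ j ≤ k, arrivalTime a (k + 1) ≤ arrivalTime a j + s j

lemma connected_succ {n : ℕ} :
    Connected a s (n + 1) ↔
      Connected a s n ∧ ∃ j ≤ n, arrivalTime a (n + 1) ≤ arrivalTime a j + s j := by
  constructor
  · exact fun h ↦ ⟨fun k hk ↦ h k (hk.trans n.lt_succ_self), h n n.lt_succ_self⟩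
  · rintro ⟨h1, h2⟩ k hk
    rcases (Nat.lt_succ_iff.1 hk).lt_or_eq with h | rfl
    exacts [h1 k h, h2]

lemma connected_congr {a' s' : ℕ → ℝ} {n : ℕ} (ha : ∀ i ≤ n, a i = a' i)
    (hs : ∀ i < n, s i = s' i) : Connected a s n ↔ Connected a' s' n := by
  refine forall₂_congr fun k hk ↦ exists_congr fun j ↦ and_congr_right fun hj ↦ ?_
  rw [arrivalTime_congr fun i hi ↦ ha i (hi.trans hk),
    arrivalTime_congr fun i hi ↦ ha i (hi.trans (hj.trans hk.le)), hs j (hj.trans_lt hk)]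

/-- The busy cycle is not over at time `t`: either no customer has arrived, or some customer present
at time `t` arrived before the end of the busy period. -/
def Unfinished (a s : ℕ → ℝ) (t : ℝ) : Prop :=
  t < a 0 ∨ ∃ n, Connected a s n ∧ n ∈ present a s t

/-- A gap in the chain of overlapping services is exactly a moment when the system is empty. This
links the combinatorial condition to the first emptying time. -/
lemma unfinished_iff_forall (ha : ∀ n, 0 < a n) {t : ℝ} :
    Unfinished a s t ↔ ∀ r, a 0 ≤ r → r ≤ t → (present a s r).Nonempty := by
  have hT := arrivalTime_strictMono ha
  constructor
  · rintro (h | ⟨n, hc, h1, h2⟩) r hr hrt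
    · linarith
    by_cases hn : arrivalTime a n ≤ r
    · exact ⟨n, hn, hrt.trans_lt h2⟩
    have hex : ∃ k, r < arrivalTime a (k + 1) := by
      cases n with
      | zero => simp at hn; linarith
      | succ k => exact ⟨k, not_le.1 hn⟩
    classical
    let k := Nat.find hex
    have hk : r < arrivalTime a (k + 1) := Nat.find_spec hex
    have hk' : arrivalTime a k ≤ r := by
      rcases Nat.eq_zero_or_pos k with h0 | h0
      · rw [h0, arrivalTime_zero]; exact hr
      · have := Nat.find_min hex (m := k - 1) (by omega)
        rwa [not_lt, Nat.sub_add_cancel h0] at this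
    have hkn : k < n := hT.lt_iff_lt.1 (hk'.trans_lt (not_le.1 hn))
    obtain ⟨j, hj, hjk⟩ := hc k hkn
    exact ⟨j, (hT.monotone hj).trans hk', hk.trans_le hjk⟩
  · intro h
    by_cases h0 : t < a 0
    · exact Or.inl h0
    obtain ⟨n, hn⟩ := h t (not_lt.1 h0) le_rfl
    refine Or.inr ⟨n, fun k hk ↦ ?_, hn⟩
    by_contra! hcon
    -- If the chain breaks after customer k, the system is empty at the last departure among 0, …,
    -- k, or at the arrival of k should that be later; the maximum keeps r after the first arrival.
    obtain ⟨r, hr1, hr2, hr3⟩ : ∃ r, arrivalTime a k ≤ r ∧ r < arrivalTime a (k + 1) ∧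
        ∀ j ≤ k, arrivalTime a j + s j ≤ r := by
      obtain ⟨j₀, hj₀, hmax⟩ := (Finset.range (k + 1)).exists_max_image
        (fun j ↦ arrivalTime a j + s j) ⟨0, by simp⟩
      refine ⟨max (arrivalTime a k) (arrivalTime a j₀ + s j₀), le_max_left _ _,
        max_lt (hT k.lt_succ_self) (hcon j₀ (by simpa [Nat.lt_succ_iff] using hj₀)),
        fun j hj ↦ le_max_of_le_right (hmax j (by simpa [Nat.lt_succ_iff] using hj))⟩
    obtain ⟨j, hj1, hj2⟩ := h r
      (by simpa using (hT.monotone (Nat.zero_le k)).trans hr1)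
      (hr2.le.trans ((hT.monotone hk).trans hn.1))
    exact absurd (hr3 j (Nat.lt_succ_iff.1 (hT.lt_iff_lt.1 (hj1.trans_lt hr2)))) (not_le.2 hj2)

lemma numInSystem_eq_zero {t : ℝ} : numInSystem a s t = 0 ↔ ¬ (present a s t).Nonempty := by
  rw [numInSystem, encard_eq_zero, not_nonempty_iff_eq_empty]

lemma idlePeriod_eq (ha : ∀ n, 0 < a n) (hs : 0 < s 0) : idlePeriod a s = a 0 := by
  have h : IsLeast {t : ℝ | 0 ≤ t ∧ numInSystem a s t ≠ 0} (a 0) := by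
    refine ⟨⟨(ha 0).le, ?_⟩, fun t ht ↦ ?_⟩
    · exact fun h ↦ numInSystem_eq_zero.1 h ⟨0, by simp, by simpa using hs⟩
    · obtain ⟨n, hn⟩ := not_not.1 (mt numInSystem_eq_zero.2 ht.2)
      simpa using ((arrivalTime_strictMono ha).monotone (Nat.zero_le n)).trans hn.1
  exact h.csInf_eq

lemma busyCycle_le_iff (ha : ∀ n, 0 < a n) (hs : 0 < s 0) {t : ℝ} :
    busyCycle a s ≤ t ↔ ¬ Unfinished a s t := by
  rw [unfinished_iff_forall ha, busyCycle, busyPeriod, idlePeriod_eq ha hs]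
  constructor
  · contrapose!
    intro h
    -- A bound strictly beyond t is needed, since an infimum of times > t could equal t. A customer
    -- present at t supplies it: the system stays nonempty until that departure.
    obtain ⟨v, hv, htv⟩ : ∃ v : ℝ, (v : EReal) ≤
        ⨅ u ∈ {u : ℝ | 0 ≤ u ∧ numInSystem a s (a 0 + u) = 0}, (u : EReal) ∧ t < a 0 + v := by
      rcases lt_or_ge t (a 0) with h0 | h0
      · refine ⟨0, le_iInf₂ fun u hu ↦ EReal.coe_le_coe_iff.2 hu.1, by simpa using h0⟩
      · obtain ⟨n, hn1, hn2⟩ := h t h0 le_rfl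
        refine ⟨arrivalTime a n + s n - a 0, le_iInf₂ fun u hu ↦ EReal.coe_le_coe_iff.2 ?_,
          by linarith⟩
        have hu2 := numInSystem_eq_zero.1 hu.2
        by_contra! hlt
        have htu : t < a 0 + u := by
          by_contra! hle
          exact hu2 (h _ (by linarith [hu.1]) hle)
        exact hu2 ⟨n, by linarith, by linarith⟩
    calc (t : EReal) < ((a 0 + v : ℝ) : EReal) := EReal.coe_lt_coe_iff.2 htv
      _ = (a 0 : EReal) + v := EReal.coe_add _ _
      _ ≤ _ := by gcongr
  · intro h
    push Not at h
    obtain ⟨r, hr, hrt, hemp⟩ := h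
    have hmem : r - a 0 ∈ {u : ℝ | 0 ≤ u ∧ numInSystem a s (a 0 + u) = 0} :=
      ⟨by linarith, by rw [numInSystem_eq_zero]; simp [hemp]⟩
    calc _ ≤ (a 0 : EReal) + ((r - a 0 : ℝ) : EReal) := by
          gcongr
          exact iInf₂_le _ hmem
      _ = (r : EReal) := by rw [← EReal.coe_add]; congr 1; ring
      _ ≤ t := EReal.coe_le_coe_iff.2 hrt

/-- Customer `n` is the last to arrive before time `u`, and the busy cycle is not over then. -/
def UnfinishedAfter (a s : ℕ → ℝ) (n : ℕ) (u : ℝ) : Prop :=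
  Connected a s n ∧ (∃ j ≤ n, u < arrivalTime a j + s j) ∧
    arrivalTime a n ≤ u ∧ u < arrivalTime a n + a (n + 1)

lemma UnfinishedAfter.eq (ha : ∀ n, 0 < a n) {m n : ℕ} {u : ℝ} (hm : UnfinishedAfter a s m u)
    (hn : UnfinishedAfter a s n u) : m = n := by
  have hT := arrivalTime_strictMono ha
  obtain ⟨-, -, hm1, hm2⟩ := hm
  obtain ⟨-, -, hn1, hn2⟩ := hn
  rw [← arrivalTime_succ] at hm2 hn2
  have h1 := hT.lt_iff_lt.1 (hm1.trans_lt hn2)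
  have h2 := hT.lt_iff_lt.1 (hn1.trans_lt hm2)
  omega

lemma UnfinishedAfter.le (ha : ∀ n, 0 < a n) {n : ℕ} {u : ℝ} (h : UnfinishedAfter a s n u) :
    a 0 ≤ u := by
  simpa using ((arrivalTime_strictMono ha).monotone (Nat.zero_le n)).trans h.2.2.1

/-- Indexing by the last arrival before u, instead of by a customer present at u, makes the events
disjoint. The chain extends from a present customer m to the last arrival n because m itself is
still there at all arrivals in between. -/
lemma unfinished_iff_unfinishedAfter (ha : ∀ n, 0 < a n) {u : ℝ} (hu : ∃ n, u < arrivalTime a n) :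
    Unfinished a s u ↔ u < a 0 ∨ ∃ n, UnfinishedAfter a s n u := by
  have hT := arrivalTime_strictMono ha
  rw [Unfinished]
  refine or_congr_right' fun h0 ↦ ⟨?_, ?_⟩
  · rintro ⟨m, hc, hm1, hm2⟩
    classical
    have hn := Nat.find_spec hu
    obtain ⟨n, hn'⟩ : ∃ n, Nat.find hu = n + 1 := by
      refine Nat.exists_eq_succ_of_ne_zero fun h ↦ h0 ?_
      rw [h] at hn
      simpa using hn
    rw [hn'] at hn
    have hnu : arrivalTime a n ≤ u := not_lt.1 (Nat.find_min hu (by omega))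
    have hmn : m ≤ n := Nat.lt_succ_iff.1 (hT.lt_iff_lt.1 (hm1.trans_lt hn))
    refine ⟨n, fun k hk ↦ ?_, ⟨m, hmn, hm2⟩, hnu, by rwa [← arrivalTime_succ]⟩
    rcases lt_or_ge k m with hkm | hkm
    · exact hc k hkm
    · exact ⟨m, hkm, (hT.monotone hk).trans (hnu.trans hm2.le)⟩
  · rintro ⟨n, hc, ⟨j, hj, hju⟩, hn1, -⟩
    exact ⟨j, fun k hk ↦ hc k (hk.trans_le hj), (hT.monotone hj).trans hn1, hju⟩

/-- None of the customers `k, …, k + m - 1` is present at the moment that comes `r` after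
the arrival of customer `k - 1`. -/
def NonePresent (a s : ℕ → ℝ) : ℕ → ℕ → ℝ → Prop
  | 0, _, _ => True
  | m + 1, k, r => r < a k ∨ (a k + s k ≤ r ∧ NonePresent a s m (k + 1) (r - a k))

lemma nonePresent_congr {a' s' : ℕ → ℝ} {m k : ℕ} {r : ℝ}
    (ha : ∀ i, k ≤ i → i < k + m → a i = a' i) (hs : ∀ i, k ≤ i → i < k + m → s i = s' i) :
    NonePresent a s m k r ↔ NonePresent a' s' m k r := by
  induction m generalizing k r with
  | zero => rfl
  | succ m ih =>
    simp only [NonePresent]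
    rw [ha k le_rfl (by omega), hs k le_rfl (by omega),
      ih (fun i hi hi' ↦ ha i (by omega) (by omega)) fun i hi hi' ↦ hs i (by omega) (by omega)]

lemma NonePresent.notMem_present (ha : ∀ n, 0 < a n) {t : ℝ} {n m k : ℕ} (hnk : n < k)
    (hkm : k ≤ n + m) (h : NonePresent a s m (n + 1) (t - arrivalTime a n)) :
    k ∉ present a s t := by
  have hT := arrivalTime_strictMono ha
  rintro ⟨h1, h2⟩
  induction m generalizing n with
  | zero => omega
  | succ m ih =>
    have hs := arrivalTime_succ (a := a) n
    rcases h with h | ⟨h3, h4⟩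
    · have := hT.monotone hnk
      simp only [Nat.succ_eq_add_one] at this
      linarith
    · rcases Nat.lt_or_ge (n + 1) k with hk | hk
      · refine ih hk (by omega) ?_
        rwa [hs, ← sub_sub]
      · obtain rfl : k = n + 1 := by omega
        linarith

end Paths

/-! ### Measurability of the path events -/

section Measurability

variable {β : Type*} [MeasurableSpace β] {a s : β → ℕ → ℝ} {f : β → ℝ}

@[fun_prop]
lemma measurable_arrivalTime (ha : Measurable a) (n : ℕ) :
    Measurable fun b ↦ arrivalTime (a b) n :=
  Finset.measurable_fun_sum _ fun i _ ↦ (measurable_pi_apply i).comp ha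

lemma measurableSet_connected (ha : Measurable a) (hs : Measurable s) (n : ℕ) :
    MeasurableSet {b | Connected (a b) (s b) n} := by
  simp only [Connected, ofPred_forall, ofPred_exists, ofPred_and]
  refine .iInter fun k ↦ .iInter fun _ ↦ .iUnion fun j ↦ (MeasurableSet.const _).inter ?_
  exact measurableSet_le (by fun_prop) (by fun_prop)

lemma measurableSet_exists_lt_departure (ha : Measurable a) (hs : Measurable s)
    (hf : Measurable f) (n : ℕ) :
    MeasurableSet {b | ∃ j ≤ n, f b < arrivalTime (a b) j + s b j} := by
  simp only [ofPred_exists, ofPred_and]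
  refine .iUnion fun j ↦ (MeasurableSet.const _).inter ?_
  exact measurableSet_lt (by fun_prop) (by fun_prop)

lemma measurableSet_exists_le_departure (ha : Measurable a) (hs : Measurable s)
    (hf : Measurable f) (n : ℕ) :
    MeasurableSet {b | ∃ j ≤ n, f b ≤ arrivalTime (a b) j + s b j} := by
  simp only [ofPred_exists, ofPred_and]
  refine .iUnion fun j ↦ (MeasurableSet.const _).inter ?_
  exact measurableSet_le (by fun_prop) (by fun_prop)

lemma measurableSet_unfinishedAfter (ha : Measurable a) (hs : Measurable s)
    (hf : Measurable f) (n : ℕ) :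
    MeasurableSet {b | UnfinishedAfter (a b) (s b) n (f b)} :=
  (measurableSet_connected ha hs n).inter <|
    (measurableSet_exists_lt_departure ha hs hf n).inter <|
    (measurableSet_le (by fun_prop) hf).inter (measurableSet_lt hf (by fun_prop))

lemma measurableSet_mem_present (ha : Measurable a) (hs : Measurable s)
    (hf : Measurable f) (n : ℕ) : MeasurableSet {b | n ∈ present (a b) (s b) (f b)} :=
  (measurableSet_le (by fun_prop) hf).inter (measurableSet_lt hf (by fun_prop))

lemma measurableSet_unfinished (ha : Measurable a) (hs : Measurable s) (hf : Measurable f) :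
    MeasurableSet {b | Unfinished (a b) (s b) (f b)} := by
  simp only [Unfinished, ofPred_or, ofPred_exists]
  exact (measurableSet_lt hf (by fun_prop)).union <| .iUnion fun n ↦
    (measurableSet_connected ha hs n).inter (measurableSet_mem_present ha hs hf n)

lemma measurableSet_nonePresent (ha : Measurable a) (hs : Measurable s) (hf : Measurable f)
    (m k : ℕ) : MeasurableSet {b | NonePresent (a b) (s b) m k (f b)} := by
  induction m generalizing k f with
  | zero => exact .univ
  | succ m ih =>
    exact (measurableSet_lt hf (by fun_prop)).union <|
      (measurableSet_le (by fun_prop) hf).inter (ih (by fun_prop) (k + 1))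

end Measurability

/-! ### The law on path space and the intensity of arrivals in the busy cycle -/

/-- The interarrival times of a path. -/
def interarrival (x : ℕ ⊕ ℕ → ℝ) (n : ℕ) : ℝ := x (.inl n)

/-- The service times of a path. -/
def service (x : ℕ ⊕ ℕ → ℝ) (n : ℕ) : ℝ := x (.inr n)

@[fun_prop]
lemma measurable_interarrival : Measurable interarrival :=
  measurable_pi_lambda _ fun _ ↦ measurable_pi_apply _

@[fun_prop]
lemma measurable_service : Measurable service :=
  measurable_pi_lambda _ fun _ ↦ measurable_pi_apply _

/-- `Q` is the joint law of the interarrival times and the service times of a queue. -/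
abbrev IsQueueLaw (Q : Measure (ℕ ⊕ ℕ → ℝ)) (lam α : ℝ) : Prop :=
  IsQueue Q lam α (fun n x ↦ interarrival x n) fun n x ↦ service x n

section Law

variable {Q : Measure (ℕ ⊕ ℕ → ℝ)} {lam α : ℝ}

lemma IsQueueLaw.iIndepFun (hQ : IsQueueLaw Q lam α) :
    iIndepFun (fun i (x : ℕ ⊕ ℕ → ℝ) ↦ x i) Q := by
  convert hQ.indep using 2 with i
  cases i <;> rfl

lemma IsQueueLaw.measure_interarrival (hQ : IsQueueLaw Q lam α) (n : ℕ) {B : Set ℝ}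
    (hB : MeasurableSet B) : Q {x | interarrival x n ∈ B} = expMeasure lam B :=
  (hQ.hasLaw_interarrival n).measure_eq hB

lemma IsQueueLaw.measure_service (hQ : IsQueueLaw Q lam α) (n : ℕ) {B : Set ℝ}
    (hB : MeasurableSet B) : Q {x | service x n ∈ B} = expMeasure α⁻¹ B :=
  (hQ.hasLaw_service n).measure_eq hB

lemma IsQueueLaw.lintegral_interarrival (hQ : IsQueueLaw Q lam α) (n : ℕ) {f : ℝ → ℝ≥0∞}
    (hf : Measurable f) : ∫⁻ x, f (interarrival x n) ∂Q = ∫⁻ a, f a ∂expMeasure lam := by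
  rw [← (hQ.hasLaw_interarrival n).map_eq, lintegral_map hf (by fun_prop)]

lemma IsQueueLaw.ae_pos (hQ : IsQueueLaw Q lam α) (hlam : 0 < lam) (hα : 0 < α) :
    ∀ᵐ x ∂Q, (∀ n, 0 < interarrival x n) ∧ ∀ n, 0 < service x n := by
  refine (ae_all_iff.2 fun n ↦ ?_).and (ae_all_iff.2 fun n ↦ ?_)
  · have := hQ.measure_interarrival n measurableSet_Iic (B := Iic 0)
    rw [expMeasure_Iic_zero hlam] at this
    simpa [ae_iff] using this
  · have := hQ.measure_service n measurableSet_Iic (B := Iic 0)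
    rw [expMeasure_Iic_zero (inv_pos.2 hα)] at this
    simpa [ae_iff] using this

/-- The arrival instants tend to infinity. -/
lemma IsQueueLaw.ae_exists_lt_arrivalTime (hQ : IsQueueLaw Q lam α) (hlam : 0 < lam) (hα : 0 < α) :
    ∀ᵐ x ∂Q, ∀ u : ℝ, ∃ n, u < arrivalTime (interarrival x) n := by
  have := hQ.indep.isProbabilityMeasure
  have hq : expMeasure lam (Iic 1) < 1 := by
    rw [expMeasure_Iic hlam zero_le_one, ← ENNReal.ofReal_one]
    exact (ENNReal.ofReal_lt_ofReal_iff one_pos).2 (by linarith [Real.exp_pos (-(lam * 1))])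
  -- By independence N consecutive interarrival times are all at most 1 with probability qᴺ, q < 1.
  -- So almost surely infinitely many exceed 1, and the arrival instants pass every integer.
  have hblock (m N : ℕ) : Q {x | ∀ k, m ≤ k → interarrival x k ≤ 1} ≤ expMeasure lam (Iic 1) ^ N := by
    have h := hQ.iIndepFun.measure_inter_preimage_eq_mul
      ((Finset.range N).map ⟨fun k ↦ Sum.inl (m + k), fun _ _ h ↦ by simpa using h⟩)
      (sets := fun _ ↦ Iic 1) (fun _ _ ↦ measurableSet_Iic)
    have h1 (k : ℕ) : Q ((fun x : ℕ ⊕ ℕ → ℝ ↦ x (Sum.inl (m + k))) ⁻¹' Iic 1)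
        = expMeasure lam (Iic 1) := hQ.measure_interarrival (m + k) measurableSet_Iic
    rw [Finset.prod_map] at h
    replace h := h.trans (Finset.prod_congr rfl fun k _ ↦ h1 k)
    simp only [Finset.prod_const, Finset.card_range] at h
    rw [← h]
    refine measure_mono fun x hx ↦ ?_
    simp only [Finset.mem_map, Finset.mem_range, mem_iInter, mem_preimage, mem_Iic]
    rintro _ ⟨k, -, rfl⟩
    exact hx (m + k) (by omega)
  have hzero (m : ℕ) : Q {x | ∀ k, m ≤ k → interarrival x k ≤ 1} = 0 :=
    le_antisymm (ge_of_tendsto' (ENNReal.tendsto_pow_atTop_nhds_zero_of_lt_one hq) (hblock m))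
      (zero_le)
  have hae : ∀ᵐ x ∂Q, ∀ m, ∃ k, m ≤ k ∧ 1 < interarrival x k := by
    refine ae_all_iff.2 fun m ↦ ?_
    rw [ae_iff]
    simpa using hzero m
  filter_upwards [hae, hQ.ae_pos hlam hα] with x hx hpos u
  have hT := arrivalTime_strictMono hpos.1
  have hN (N : ℕ) : ∃ n, (N : ℝ) ≤ arrivalTime (interarrival x) n := by
    induction N with
    | zero => exact ⟨0, by simpa using (hpos.1 0).le⟩
    | succ N ih =>
      obtain ⟨n, hn⟩ := ih
      obtain ⟨k, hk, hk1⟩ := hx (n + 1)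
      obtain ⟨k, rfl⟩ : ∃ l, k = l + 1 := ⟨k - 1, by omega⟩
      refine ⟨k + 1, ?_⟩
      rw [arrivalTime_succ]
      push_cast
      linarith [hT.monotone (show n ≤ k by omega)]
  obtain ⟨N, hN'⟩ := exists_nat_gt u
  obtain ⟨n, hn⟩ := hN N
  exact ⟨n, hN'.trans_le hn⟩

/-- The indices of the interarrival times up to `n` and of the service times before `k`. -/
def pastIndices (n k : ℕ) : Finset (ℕ ⊕ ℕ) := (Finset.range (n + 1)).disjSum (Finset.range k)

lemma interarrival_eq_of_past {n k : ℕ} {x x' : ℕ ⊕ ℕ → ℝ}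
    (h : ∀ i ∈ (pastIndices n k : Set (ℕ ⊕ ℕ)), x i = x' i) {i : ℕ} (hi : i ≤ n) :
    interarrival x i = interarrival x' i :=
  h _ (by simpa [pastIndices, Nat.lt_succ_iff] using hi)

lemma service_eq_of_past {n k : ℕ} {x x' : ℕ ⊕ ℕ → ℝ}
    (h : ∀ i ∈ (pastIndices n k : Set (ℕ ⊕ ℕ)), x i = x' i) {i : ℕ} (hi : i < k) :
    service x i = service x' i :=
  h _ (by simpa [pastIndices] using hi)

/-- Given the past up to customer n, the next interarrival time is a fresh exponential, so
`lintegral_expMeasure_add` replaces the law of the next arrival instant by λ du on the event that it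
has not yet occurred at u. -/
lemma IsQueueLaw.lintegral_connected_succ (hQ : IsQueueLaw Q lam α) (hlam : 0 < lam)
    (n : ℕ) {g : ℝ → ℝ≥0∞} (hg : Measurable g) :
    ∫⁻ x, {x | Connected (interarrival x) (service x) (n + 1)}.indicator
        (fun x ↦ g (arrivalTime (interarrival x) (n + 1))) x ∂Q
      = ∫⁻ u, ENNReal.ofReal lam * g u *
          Q {x | UnfinishedAfter (interarrival x) (service x) n u} := by
  classical
  have := hQ.indep.isProbabilityMeasure
  let I := pastIndices n (n + 1)
  let J : Finset (ℕ ⊕ ℕ) := {.inl (n + 1)}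
  have hIJ : Disjoint I J := by simp [I, J, pastIndices]
  let F (x : ℕ ⊕ ℕ → ℝ) (u : ℝ) : ℝ≥0∞ :=
    if Connected (interarrival x) (service x) n ∧
      ∃ j ≤ n, u ≤ arrivalTime (interarrival x) j + service x j then g u else 0
  let R (u : ℝ) (x y : ℕ ⊕ ℕ → ℝ) : Prop :=
    Connected (interarrival x) (service x) n ∧
      (∃ j ≤ n, u < arrivalTime (interarrival x) j + service x j) ∧
      arrivalTime (interarrival x) n ≤ u ∧
      u < arrivalTime (interarrival x) n + interarrival y (n + 1)
  have hF : Measurable (Function.uncurry F) := by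
    refine Measurable.ite (MeasurableSet.inter ?_ ?_) (hg.comp measurable_snd) measurable_const
    · exact measurableSet_connected (by fun_prop) (by fun_prop) n
    · exact measurableSet_exists_le_departure (by fun_prop) (by fun_prop) measurable_snd n
  have hR : MeasurableSet {p : ((ℕ ⊕ ℕ → ℝ) × ℝ) × (ℕ ⊕ ℕ → ℝ) | R p.1.2 p.1.1 p.2} := by
    simp only [R, ofPred_and]
    refine .inter ?_ (.inter ?_ (.inter ?_ ?_))
    · exact measurableSet_connected (by fun_prop) (by fun_prop) n
    · exact measurableSet_exists_lt_departure (by fun_prop) (by fun_prop) (by fun_prop) n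
    · exact measurableSet_le (by fun_prop) (by fun_prop)
    · exact measurableSet_lt (by fun_prop) (by fun_prop)
  have hdep {x x' : ℕ ⊕ ℕ → ℝ} (h : ∀ i ∈ (I : Set (ℕ ⊕ ℕ)), x i = x' i) :
      (Connected (interarrival x) (service x) n ↔ Connected (interarrival x') (service x') n) ∧
      (∀ j ≤ n, arrivalTime (interarrival x) j = arrivalTime (interarrival x') j) ∧
      ∀ j ≤ n, service x j = service x' j :=
    ⟨connected_congr (fun i hi ↦ interarrival_eq_of_past h hi)
      (fun i hi ↦ service_eq_of_past h (by omega)),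
      fun j hj ↦ arrivalTime_congr fun i hi ↦ interarrival_eq_of_past h (hi.trans hj),
      fun j hj ↦ service_eq_of_past h (by omega)⟩
  have hex {x x' : ℕ ⊕ ℕ → ℝ} (h : ∀ i ∈ (I : Set (ℕ ⊕ ℕ)), x i = x' i) (r : ℝ → ℝ → Prop) (u : ℝ) :
      (∃ j ≤ n, r u (arrivalTime (interarrival x) j + service x j)) ↔
      ∃ j ≤ n, r u (arrivalTime (interarrival x') j + service x' j) :=
    exists_congr fun j ↦ and_congr_right fun hj ↦ by rw [(hdep h).2.1 j hj, (hdep h).2.2 j hj]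
  have hinner (x : ℕ ⊕ ℕ → ℝ) :
      ∫⁻ y, F x (arrivalTime (interarrival x) n + interarrival y (n + 1)) ∂Q
        = ∫⁻ u, ENNReal.ofReal lam * g u * Q {y | R u x y} := by
    have hFx : Measurable (F x) := hF.comp measurable_prodMk_left
    rw [hQ.lintegral_interarrival (n + 1)
      (f := fun a ↦ F x (arrivalTime (interarrival x) n + a)) (by fun_prop),
      lintegral_expMeasure_add hlam _ _ hFx]
    -- `Connected` compares with departures by ≤, `UnfinishedAfter` by <. They differ only when u is
    -- one of finitely many departure instants, a Lebesgue-null set.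
    have hfin : (⋃ j ∈ Finset.range (n + 1),
        {arrivalTime (interarrival x) j + service x j}).Finite :=
      (Finset.finite_toSet _).biUnion fun _ _ ↦ finite_singleton _
    refine lintegral_congr_ae ?_
    filter_upwards [compl_mem_ae_iff.2 (hfin.measure_zero volume)] with u hu
    have hu' (j : ℕ) (hj : j ≤ n) : u ≠ arrivalTime (interarrival x) j + service x j := by
      intro h
      exact hu (mem_biUnion (by simpa [Nat.lt_succ_iff] using hj) h)
    have hlt : (∃ j ≤ n, u ≤ arrivalTime (interarrival x) j + service x j) ↔
        ∃ j ≤ n, u < arrivalTime (interarrival x) j + service x j :=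
      exists_congr fun j ↦ and_congr_right fun hj ↦ (hu' j hj).le_iff_lt
    have hA : Q {y | arrivalTime (interarrival x) n ≤ u ∧
          u < arrivalTime (interarrival x) n + interarrival y (n + 1)}
        = expMeasure lam {a | arrivalTime (interarrival x) n ≤ u ∧
          u < arrivalTime (interarrival x) n + a} :=
      hQ.measure_interarrival (n + 1) (B := {a | arrivalTime (interarrival x) n ≤ u ∧
        u < arrivalTime (interarrival x) n + a}) <| by
          simp only [ofPred_and]
          exact (MeasurableSet.const _).inter (measurableSet_lt (by fun_prop) (by fun_prop))
    simp only [F, R, hlt]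
    by_cases hc : Connected (interarrival x) (service x) n ∧
        ∃ j ≤ n, u < arrivalTime (interarrival x) j + service x j
    · rw [if_pos hc, ← hA]
      congr 3
      ext y
      simp [hc]
    · rw [if_neg hc, mul_zero, zero_mul]
      simp only [← and_assoc]
      simp [hc]
  calc _ = ∫⁻ x, F x (arrivalTime (interarrival x) n + interarrival x (n + 1)) ∂Q := by
        refine lintegral_congr fun x ↦ ?_
        simp only [F, indicator, mem_ofPred_eq, connected_succ, arrivalTime_succ]
    _ = ∫⁻ x, ∫⁻ y, F x (arrivalTime (interarrival x) n + interarrival y (n + 1)) ∂Q ∂Q := by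
        refine lintegral_decouple hQ.iIndepFun hIJ (Φ := fun x y ↦
          F x (arrivalTime (interarrival x) n + interarrival y (n + 1))) ?_ (fun y x x' h ↦ ?_)
          fun x y y' h ↦ ?_
        · exact hF.comp (measurable_fst.prodMk (by fun_prop))
        · simp only [F, (hdep h).1, (hdep h).2.1 n le_rfl, hex h (· ≤ ·)]
        · have : interarrival y (n + 1) = interarrival y' (n + 1) := h _ (by simp [J])
          simp only [this]
    _ = ∫⁻ x, (∫⁻ u, ENNReal.ofReal lam * g u * Q {y | R u x y}) ∂Q := lintegral_congr hinner
    _ = ∫⁻ u : ℝ, ∫⁻ x, ENNReal.ofReal lam * g u * Q {y | R u x y} ∂Q := by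
        refine lintegral_lintegral_swap (Measurable.aemeasurable ?_)
        have h1 : Measurable fun p : (ℕ ⊕ ℕ → ℝ) × ℝ ↦ Q {y | R p.2 p.1 y} :=
          measurable_measure_prodMk_left hR
        exact (by fun_prop : Measurable fun p : (ℕ ⊕ ℕ → ℝ) × ℝ ↦ ENNReal.ofReal lam * g p.2).mul h1
    _ = _ := by
        refine lintegral_congr fun u ↦ ?_
        have hRu : MeasurableSet {p : (ℕ ⊕ ℕ → ℝ) × (ℕ ⊕ ℕ → ℝ) | R u p.1 p.2} :=
          hR.preimage (f := fun p : (ℕ ⊕ ℕ → ℝ) × (ℕ ⊕ ℕ → ℝ) ↦ ((p.1, u), p.2)) (by fun_prop)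
        have hRm : Measurable fun x ↦ Q {y | R u x y} := measurable_measure_prodMk_left hRu
        rw [lintegral_const_mul _ hRm,
          ← measure_decouple hQ.iIndepFun hIJ hRu]
        · rfl
        · intro y x x' h
          simp only [R, (hdep h).1, (hdep h).2.1 n le_rfl, hex h (· < ·)]
        · intro x y y' h
          have : interarrival y (n + 1) = interarrival y' (n + 1) := h _ (by simp [J])
          simp only [R, this]

end Law

lemma setLIntegral_Icc_ofReal {f : ℝ → ℝ} {t : ℝ} (ht : 0 ≤ t)
    (hf : IntervalIntegrable f volume 0 t) (h0 : ∀ u ∈ Icc 0 t, 0 ≤ f u) :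
    ∫⁻ u in Icc 0 t, ENNReal.ofReal (f u) = ENNReal.ofReal (∫ u in 0..t, f u) := by
  rw [intervalIntegral.integral_of_le ht, ← integral_Icc_eq_integral_Ioc,
    ofReal_integral_eq_lintegral_ofReal]
  · exact (integrableOn_Icc_iff_integrableOn_Ioc (by simp)).2 <|
      (intervalIntegrable_iff_integrableOn_Ioc_of_le ht).1 hf
  · exact (ae_restrict_iff' measurableSet_Icc).2 (.of_forall h0)

lemma measure_and_eq_mul {ι : Type*} {Q : Measure (ι → ℝ)} [IsProbabilityMeasure Q]
    (h : iIndepFun (fun i (x : ι → ℝ) ↦ x i) Q) {I J : Finset ι} (hIJ : Disjoint I J)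
    {p q : (ι → ℝ) → Prop} (hp : MeasurableSet {x | p x}) (hq : MeasurableSet {x | q x})
    (hI : DependsOn p (I : Set ι)) (hJ : DependsOn q (J : Set ι)) :
    Q {x | p x ∧ q x} = Q {x | p x} * Q {x | q x} := by
  have hpq : MeasurableSet {z : (ι → ℝ) × (ι → ℝ) | p z.1 ∧ q z.2} :=
    (hp.preimage measurable_fst).inter (hq.preimage measurable_snd)
  rw [measure_decouple h hIJ (R := fun x y ↦ p x ∧ q y) hpq
    (fun y x x' hx ↦ by simp only [hI hx]) (fun x y y' hy ↦ by simp only [hJ hy]),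
    ← lintegral_indicator_one hp, ← lintegral_mul_const _ (measurable_one.indicator hp)]
  refine lintegral_congr fun x ↦ ?_
  by_cases hx : p x <;> simp [hx]

section Law

variable {Q : Measure (ℕ ⊕ ℕ → ℝ)} {lam α : ℝ}

lemma IsQueueLaw.lintegral_connected_zero (hQ : IsQueueLaw Q lam α) (hlam : 0 < lam)
    {g : ℝ → ℝ≥0∞} (hg : Measurable g) :
    ∫⁻ x, {x | Connected (interarrival x) (service x) 0}.indicator
        (fun x ↦ g (arrivalTime (interarrival x) 0)) x ∂Q
      = ∫⁻ u, ENNReal.ofReal lam * g u * Q {x | 0 ≤ u ∧ u < interarrival x 0} := by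
  have h := lintegral_expMeasure_add hlam 0 g hg
  simp only [zero_add] at h
  rw [← hQ.lintegral_interarrival 0 hg] at h
  convert! h using 1
  · simp [Connected, indicator]
  · refine lintegral_congr fun u ↦ ?_
    rw [← hQ.measure_interarrival 0 (B := {a | 0 ≤ u ∧ u < a})]
    · rfl
    · simp only [ofPred_and]
      exact (MeasurableSet.const _).inter (measurableSet_lt (by fun_prop) (by fun_prop))

/-- Decomposition according to the last arrival before u. The first term keeps 0 ≤ u so as to match
the intensity of customer 0 in `IsQueueLaw.lintegral_connected_zero`. -/
lemma IsQueueLaw.measure_unfinished (hQ : IsQueueLaw Q lam α) (hlam : 0 < lam) (hα : 0 < α)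
    {u : ℝ} (hu : 0 ≤ u) :
    Q {x | Unfinished (interarrival x) (service x) u} = Q {x | 0 ≤ u ∧ u < interarrival x 0} +
      ∑' n, Q {x | UnfinishedAfter (interarrival x) (service x) n u} := by
  have hpos := hQ.ae_pos hlam hα
  have hdisj : Pairwise (Function.onFun (AEDisjoint Q)
      fun n ↦ {x | UnfinishedAfter (interarrival x) (service x) n u}) := by
    refine fun m n hmn ↦ measure_mono_null (fun x hx ↦ ?_) (ae_iff.1 hpos)
    exact fun h ↦ hmn (UnfinishedAfter.eq h.1 hx.1 hx.2)
  have hmeas (n : ℕ) : MeasurableSet {x | UnfinishedAfter (interarrival x) (service x) n u} :=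
    measurableSet_unfinishedAfter (by fun_prop) (by fun_prop) measurable_const n
  rw [← measure_iUnion₀ hdisj fun n ↦ (hmeas n).nullMeasurableSet,
    ← measure_union₀ (MeasurableSet.iUnion hmeas).nullMeasurableSet]
  · refine measure_congr ?_
    filter_upwards [hpos, hQ.ae_exists_lt_arrivalTime hlam hα] with x hx hx'
    refine propext ((unfinished_iff_unfinishedAfter hx.1 (hx' u)).trans ?_)
    change _ ↔ (0 ≤ u ∧ u < interarrival x 0) ∨
      x ∈ ⋃ n, {x | UnfinishedAfter (interarrival x) (service x) n u}
    simp [hu]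
  · refine measure_mono_null (fun x hx ↦ ?_) (ae_iff.1 hpos)
    intro h
    obtain ⟨n, hn⟩ := mem_iUnion.1 hx.2
    exact absurd hx.1.2 (not_lt.2 (UnfinishedAfter.le h.1 hn))

/-- The arrivals before the end of the busy period form a point process whose intensity at time `u`
is `lam` times the probability that the busy cycle is not over. -/
lemma IsQueueLaw.tsum_lintegral_connected (hQ : IsQueueLaw Q lam α) (hlam : 0 < lam) (hα : 0 < α)
    {g : ℝ → ℝ≥0∞} (hg : Measurable g) (hg0 : ∀ u < 0, g u = 0) :
    ∑' n, ∫⁻ x, {x | Connected (interarrival x) (service x) n}.indicator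
        (fun x ↦ g (arrivalTime (interarrival x) n)) x ∂Q
      = ∫⁻ u, ENNReal.ofReal lam * g u * Q {x | Unfinished (interarrival x) (service x) u} := by
  have := hQ.indep.isProbabilityMeasure
  have hm (n : ℕ) : Measurable fun u ↦
      Q {x | UnfinishedAfter (interarrival x) (service x) n u} :=
    measurable_measure_prodMk_left (s := {p : ℝ × (ℕ ⊕ ℕ → ℝ) |
      UnfinishedAfter (interarrival p.2) (service p.2) n p.1})
      (measurableSet_unfinishedAfter (by fun_prop) (by fun_prop) measurable_fst n)
  have hm' (n : ℕ) : Measurable fun u ↦ ENNReal.ofReal lam * g u *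
      Q {x | UnfinishedAfter (interarrival x) (service x) n u} := (hg.const_mul _).mul (hm n)
  rw [tsum_eq_zero_add' ENNReal.summable, hQ.lintegral_connected_zero hlam hg]
  simp only [hQ.lintegral_connected_succ hlam _ hg]
  rw [← lintegral_tsum fun n ↦ (hm' n).aemeasurable, ← lintegral_add_right]
  · refine lintegral_congr fun u ↦ ?_
    rcases lt_or_ge u 0 with hu | hu
    · simp [hg0 u hu]
    · rw [hQ.measure_unfinished hlam hα hu, ENNReal.tsum_mul_left, mul_add]
  · exact Measurable.tsum hm'

/-! ### The upper integral inequality -/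

/-- The probability that a service that starts at time `u` is in progress at time `t`. -/
noncomputable def survival (α t u : ℝ) : ℝ≥0∞ :=
  (Icc 0 t).indicator (fun u ↦ ENNReal.ofReal (Real.exp (-(α⁻¹ * (t - u))))) u

lemma measurable_survival (α t : ℝ) : Measurable (survival α t) :=
  Measurable.indicator (by fun_prop) measurableSet_Icc

lemma IsQueueLaw.measure_lt_service (hQ : IsQueueLaw Q lam α) (hα : 0 < α) {t u : ℝ}
    (hu : 0 ≤ u) (hut : u ≤ t) (n : ℕ) : Q {x | t - u < service x n} = survival α t u := by
  rw [survival, indicator_of_mem (mem_Icc.2 ⟨hu, hut⟩),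
    ← expMeasure_Ioi (inv_pos.2 hα) (sub_nonneg.2 hut)]
  exact hQ.measure_service n measurableSet_Ioi

/-- The service of n is independent of `Connected` and of the arrival instant of n, so it can be
integrated out first. -/
lemma IsQueueLaw.measure_present (hQ : IsQueueLaw Q lam α) (hlam : 0 < lam) (hα : 0 < α)
    (n : ℕ) (t : ℝ) :
    Q {x | Connected (interarrival x) (service x) n ∧
        n ∈ present (interarrival x) (service x) t} =
      ∫⁻ x, {x | Connected (interarrival x) (service x) n}.indicator
        (fun x ↦ survival α t (arrivalTime (interarrival x) n)) x ∂Q := by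
  have hIJ : Disjoint (pastIndices n n) {.inr n} := by simp [pastIndices]
  have := hQ.indep.isProbabilityMeasure
  refine Eq.trans ?_ ((measure_decouple hQ.iIndepFun hIJ (R := fun x y ↦
    Connected (interarrival x) (service x) n ∧
    arrivalTime (interarrival x) n ≤ t ∧
    t < arrivalTime (interarrival x) n + service y n) ?_ ?_ ?_).trans ?_)
  · rfl
  · simp only [ofPred_and]
    refine .inter ?_ (.inter ?_ ?_)
    · exact measurableSet_connected (by fun_prop) (by fun_prop) n
    · exact measurableSet_le (by fun_prop) (by fun_prop)
    · exact measurableSet_lt (by fun_prop) (by fun_prop)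
  · intro y x x' h
    simp only [arrivalTime_congr fun i hi ↦ interarrival_eq_of_past h hi,
      connected_congr (fun i hi ↦ interarrival_eq_of_past h hi)
        fun i hi ↦ service_eq_of_past h hi]
  · intro x y y' h
    have : service y n = service y' n := h _ (by simp)
    simp only [this]
  · refine lintegral_congr_ae ?_
    filter_upwards [hQ.ae_pos hlam hα] with x hx
    have h0 : 0 ≤ arrivalTime (interarrival x) n := Finset.sum_nonneg fun i _ ↦ (hx.1 i).le
    by_cases hc : Connected (interarrival x) (service x) n
    · rw [indicator_of_mem (show x ∈ {x | Connected (interarrival x) (service x) n} from hc)]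
      by_cases ht : arrivalTime (interarrival x) n ≤ t
      · rw [← hQ.measure_lt_service hα h0 ht n]
        simp [hc, ht, sub_lt_iff_lt_add']
      · rw [survival, indicator_of_notMem (by simp [ht])]
        simp [ht]
    · rw [indicator_of_notMem (show x ∉ {x | Connected (interarrival x) (service x) n} from hc)]
      simp [hc]

lemma IsQueueLaw.measure_lt_interarrival (hQ : IsQueueLaw Q lam α) (hlam : 0 < lam) {t : ℝ}
    (ht : 0 ≤ t) (n : ℕ) :
    Q {x | t < interarrival x n} = ENNReal.ofReal (Real.exp (-(lam * t))) := by
  rw [← expMeasure_Ioi hlam ht]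
  exact hQ.measure_interarrival n measurableSet_Ioi

/-- Union bound over the customer present at t. -/
lemma IsQueueLaw.measure_unfinished_le (hQ : IsQueueLaw Q lam α) (hlam : 0 < lam) (hα : 0 < α)
    {t : ℝ} (ht : 0 ≤ t) :
    Q {x | Unfinished (interarrival x) (service x) t} ≤
      ENNReal.ofReal (Real.exp (-(lam * t))) + ∫⁻ u, ENNReal.ofReal lam * survival α t u *
        Q {x | Unfinished (interarrival x) (service x) u} := by
  rw [← hQ.tsum_lintegral_connected hlam hα (measurable_survival α t)
    fun u hu ↦ indicator_of_notMem (by simp [hu]) _]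
  simp only [← hQ.measure_present hlam hα]
  rw [← hQ.measure_lt_interarrival hlam ht 0]
  refine (measure_mono (t := {x | t < interarrival x 0} ∪ ⋃ n, {x | Connected (interarrival x)
    (service x) n ∧ n ∈ present (interarrival x) (service x) t}) ?_).trans
    ((measure_union_le _ _).trans (by gcongr; exact measure_iUnion_le _))
  rintro x (h | ⟨n, hn⟩)
  · exact Or.inl h
  · exact Or.inr (mem_iUnion.2 ⟨n, hn⟩)

end Law

/-! ### The emptiness probability and the lower integral inequality -/

/-- The probability that the system is empty at time `r`. -/
noncomputable def emptyProb (lam α r : ℝ) : ℝ :=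
  Real.exp (-(lam * α * (1 - Real.exp (-(α⁻¹ * r)))))

lemma hasDerivAt_emptyProb {lam α : ℝ} (hα : α ≠ 0) (r : ℝ) :
    HasDerivAt (emptyProb lam α)
      (-(lam * Real.exp (-(α⁻¹ * r)) * emptyProb lam α r)) r := by
  have h1 : HasDerivAt (fun r ↦ Real.exp (-(α⁻¹ * r))) (Real.exp (-(α⁻¹ * r)) * -(α⁻¹ * 1)) r :=
    ((hasDerivAt_id r).const_mul α⁻¹).neg.exp
  have h2 := ((h1.const_sub 1).const_mul (lam * α)).neg.exp
  unfold emptyProb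
  convert! h2 using 1
  simp only [Pi.neg_apply]
  field_simp

@[fun_prop]
lemma continuous_emptyProb (lam α : ℝ) : Continuous (emptyProb lam α) := by
  unfold emptyProb
  fun_prop

lemma emptyProb_nonneg (lam α r : ℝ) : 0 ≤ emptyProb lam α r := (Real.exp_pos _).le

lemma emptyProb_le_one {lam α r : ℝ} (hlam : 0 < lam) (hα : 0 < α) (hr : 0 ≤ r) :
    emptyProb lam α r ≤ 1 := by
  refine Real.exp_le_one_iff.2 (neg_nonpos.2 (mul_nonneg (by positivity) (sub_nonneg.2 ?_)))
  exact Real.exp_le_one_iff.2 (by simp only [Left.neg_nonpos_iff]; positivity)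

lemma exp_neg_le_emptyProb {lam α : ℝ} (hlam : 0 < lam) (hα : 0 < α) (r : ℝ) :
    Real.exp (-(lam * α)) ≤ emptyProb lam α r := by
  refine Real.exp_le_exp.2 (neg_le_neg ?_)
  have : 0 < lam * α := by positivity
  nlinarith [Real.exp_pos (-(α⁻¹ * r))]

/-- The renewal equation for `emptyProb`. -/
lemma emptyProb_eq {lam α : ℝ} (hα : α ≠ 0) (r : ℝ) :
    ∫ a in 0..r, lam * Real.exp (-(lam * a)) *
        ((1 - Real.exp (-(α⁻¹ * (r - a)))) * emptyProb lam α (r - a))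
      = emptyProb lam α r - Real.exp (-(lam * r)) := by
  have hderiv (a : ℝ) : HasDerivAt (fun a ↦ -(Real.exp (-(lam * a)) * emptyProb lam α (r - a)))
      (lam * Real.exp (-(lam * a)) *
        ((1 - Real.exp (-(α⁻¹ * (r - a)))) * emptyProb lam α (r - a))) a := by
    have h1 : HasDerivAt (fun a ↦ Real.exp (-(lam * a))) (Real.exp (-(lam * a)) * -(lam * 1)) a :=
      ((hasDerivAt_id a).const_mul lam).neg.exp
    have h2 := (hasDerivAt_emptyProb (lam := lam) hα (r - a)).comp a ((hasDerivAt_id a).const_sub r)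
    convert! (h1.mul h2).neg using 1
    simp only [Function.comp_apply]
    ring
  rw [intervalIntegral.integral_eq_sub_of_hasDerivAt (fun a _ ↦ hderiv a)
    (Continuous.intervalIntegrable (by fun_prop) _ _)]
  simp [emptyProb]
  ring

section Law

variable {Q : Measure (ℕ ⊕ ℕ → ℝ)} {lam α : ℝ}

/-- Induction on m by conditioning on the next interarrival time, with `emptyProb_eq` closing the
step. Only m customers are inspected, hence an inequality, which starts from `emptyProb` ≤ 1. -/
lemma IsQueueLaw.emptyProb_le (hQ : IsQueueLaw Q lam α) (hlam : 0 < lam) (hα : 0 < α)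
    (m k : ℕ) {r : ℝ} (hr : 0 ≤ r) :
    ENNReal.ofReal (emptyProb lam α r) ≤
      Q {x | NonePresent (interarrival x) (service x) m k r} := by
  have := hQ.indep.isProbabilityMeasure
  induction m generalizing k r with
  | zero =>
    simp only [NonePresent, ofPred_true, measure_univ]
    exact ENNReal.ofReal_le_one.2 (emptyProb_le_one hlam hα hr)
  | succ m ih =>
    let J : Finset (ℕ ⊕ ℕ) := (Finset.Ico (k + 1) (k + 1 + m)).disjSum (Finset.Ico k (k + 1 + m))
    have hIJ : Disjoint ({.inl k} : Finset (ℕ ⊕ ℕ)) J := by simp [J]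
    let R (x y : ℕ ⊕ ℕ → ℝ) : Prop := r < interarrival x k ∨ (interarrival x k + service y k ≤ r ∧
      NonePresent (interarrival y) (service y) m (k + 1) (r - interarrival x k))
    have hJ {y y' : ℕ ⊕ ℕ → ℝ} (h : ∀ i ∈ (J : Set (ℕ ⊕ ℕ)), y i = y' i) (q : ℝ) :
        (NonePresent (interarrival y) (service y) m (k + 1) q ↔
          NonePresent (interarrival y') (service y') m (k + 1) q) ∧ service y k = service y' k :=
      ⟨nonePresent_congr (fun i hi hi' ↦ h (.inl i) (by simp [J]; omega))
        fun i hi hi' ↦ h (.inr i) (by simp [J]; omega), h (.inr k) (by simp [J]; omega)⟩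
    have hR : MeasurableSet {p : (ℕ ⊕ ℕ → ℝ) × (ℕ ⊕ ℕ → ℝ) | R p.1 p.2} := by
      simp only [R, ofPred_or, ofPred_and]
      refine .union ?_ (.inter ?_ ?_)
      · exact measurableSet_lt (by fun_prop) (by fun_prop)
      · exact measurableSet_le (by fun_prop) (by fun_prop)
      · exact measurableSet_nonePresent (by fun_prop) (by fun_prop) (by fun_prop) m (k + 1)
    have hdec : Q {x | NonePresent (interarrival x) (service x) (m + 1) k r}
        = ∫⁻ x, Q {y | R x y} ∂Q := by
      refine measure_decouple hQ.iIndepFun hIJ hR (fun y x x' h ↦ ?_) fun x y y' h ↦ ?_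
      · have : interarrival x k = interarrival x' k := h _ (by simp)
        simp only [R, this]
      · simp only [R, (hJ h _).1, (hJ h 0).2]
    let f (a : ℝ) : ℝ := (1 - Real.exp (-(α⁻¹ * (r - a)))) * emptyProb lam α (r - a)
    -- Lower bound for the conditional probability given next interarrival time a: it is 1 if a > r;
    -- otherwise customer k must have left and the later ones must be absent, two independent
    -- events.
    let K (a : ℝ) : ℝ≥0∞ := (Ioi r).indicator 1 a +
      (Icc 0 r).indicator (fun a ↦ ENNReal.ofReal (f a)) a
    have hf0 : ∀ a ∈ Icc 0 r, 0 ≤ f a := fun a ha ↦ by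
      refine mul_nonneg (sub_nonneg.2 (Real.exp_le_one_iff.2 ?_)) (emptyProb_nonneg _ _ _)
      have := mul_nonneg (inv_pos.2 hα).le (sub_nonneg.2 ha.2)
      linarith
    have hfm : Measurable fun a ↦ ENNReal.ofReal (f a) := by
      have : Continuous f := by fun_prop
      exact this.measurable.ennreal_ofReal
    have hKle (x : ℕ ⊕ ℕ → ℝ) : K (interarrival x k) ≤ Q {y | R x y} := by
      by_cases hx : r < interarrival x k
      · have : {y | R x y} = univ := by ext y; simp [R, hx]
        simp [K, hx, this]
      · by_cases hx0 : 0 ≤ interarrival x k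
        · have hle : 0 ≤ r - interarrival x k := sub_nonneg.2 (not_lt.1 hx)
          have hRx : {y | R x y} = {y | service y k ≤ r - interarrival x k ∧
              NonePresent (interarrival y) (service y) m (k + 1) (r - interarrival x k)} := by
            ext y; simp [R, hx, le_sub_iff_add_le']
          have hdisj : Disjoint ({.inr k} : Finset (ℕ ⊕ ℕ))
              ((Finset.Ico (k + 1) (k + 1 + m)).disjSum (Finset.Ico (k + 1) (k + 1 + m))) := by
            simp
          rw [hRx, measure_and_eq_mul hQ.iIndepFun hdisj]
          · have hs : Q {y | service y k ≤ r - interarrival x k}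
                = ENNReal.ofReal (1 - Real.exp (-(α⁻¹ * (r - interarrival x k)))) := by
              rw [← expMeasure_Iic (inv_pos.2 hα) hle]
              exact hQ.measure_service k measurableSet_Iic
            have hs0 : 0 ≤ 1 - Real.exp (-(α⁻¹ * (r - interarrival x k))) := by
              refine sub_nonneg.2 (Real.exp_le_one_iff.2 ?_)
              have := mul_nonneg (inv_pos.2 hα).le hle
              linarith
            simp only [K, f, hx, hx0, not_lt.1 hx, indicator, mem_Ioi, mem_Icc, if_false, zero_add,
              and_self, if_true]
            rw [hs, ENNReal.ofReal_mul hs0]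
            gcongr
            exact ih (k + 1) hle
          · exact measurableSet_le (by fun_prop) (by fun_prop)
          · exact measurableSet_nonePresent (by fun_prop) (by fun_prop) (by fun_prop) m (k + 1)
          · intro y y' h
            have : service y k = service y' k := h _ (by simp)
            simp only [this]
          · intro y y' h
            exact propext <| nonePresent_congr (fun i hi hi' ↦ h (.inl i) (by simp; omega))
              fun i hi hi' ↦ h (.inr i) (by simp; omega)
        · simp [K, hx, hx0]
    have hpdf : ∫⁻ a, (Icc 0 r).indicator (fun a ↦ ENNReal.ofReal (f a)) a ∂expMeasure lam
        = ENNReal.ofReal (emptyProb lam α r - Real.exp (-(lam * r))) := by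
      rw [lintegral_expMeasure _ (hfm.indicator measurableSet_Icc), ← emptyProb_eq hα.ne',
        ← setLIntegral_Icc_ofReal hr, ← lintegral_indicator measurableSet_Icc]
      · refine lintegral_congr fun a ↦ ?_
        by_cases ha : a ∈ Icc 0 r
        · rw [indicator_of_mem ha, indicator_of_mem ha, exponentialPDF_of_nonneg ha.1,
            ← ENNReal.ofReal_mul (by positivity)]
        · rw [indicator_of_notMem ha, indicator_of_notMem ha, mul_zero]
      · exact Continuous.intervalIntegrable (by fun_prop) _ _
      · exact fun a ha ↦ mul_nonneg (by positivity) (hf0 a ha)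
    calc ENNReal.ofReal (emptyProb lam α r)
        ≤ ENNReal.ofReal (Real.exp (-(lam * r)) +
            (emptyProb lam α r - Real.exp (-(lam * r)))) := by simp
      _ ≤ ENNReal.ofReal (Real.exp (-(lam * r))) +
            ENNReal.ofReal (emptyProb lam α r - Real.exp (-(lam * r))) := ENNReal.ofReal_add_le
      _ = ∫⁻ a, K a ∂expMeasure lam := by
        rw [lintegral_add_left (measurable_one.indicator measurableSet_Ioi),
          lintegral_indicator_one measurableSet_Ioi, expMeasure_Ioi hlam hr, hpdf]
      _ = ∫⁻ x, K (interarrival x k) ∂Q := by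
        refine (hQ.lintegral_interarrival k ?_).symm
        exact (measurable_one.indicator measurableSet_Ioi).add (hfm.indicator measurableSet_Icc)
      _ ≤ _ := by
        rw [hdec]
        exact lintegral_mono hKle

/-- The customers after n are independent of the past, the service of n included. Seen from the
arrival of n they form a queue started empty, so `emptyProb` ≥ e^{-ρ} applies. -/
lemma IsQueueLaw.le_measure_last_present (hQ : IsQueueLaw Q lam α) (hlam : 0 < lam) (hα : 0 < α)
    (n m : ℕ) (t : ℝ) :
    ENNReal.ofReal (Real.exp (-(lam * α))) *
        Q {x | Connected (interarrival x) (service x) n ∧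
          n ∈ present (interarrival x) (service x) t} ≤
      Q {x | (Connected (interarrival x) (service x) n ∧
          n ∈ present (interarrival x) (service x) t) ∧
        NonePresent (interarrival x) (service x) m (n + 1)
          (t - arrivalTime (interarrival x) n)} := by
  have := hQ.indep.isProbabilityMeasure
  let J : Finset (ℕ ⊕ ℕ) :=
    (Finset.Ico (n + 1) (n + 1 + m)).disjSum (Finset.Ico (n + 1) (n + 1 + m))
  have hIJ : Disjoint (pastIndices n (n + 1)) J := by
    rw [Finset.disjoint_left]
    rintro (i | i) <;> simp [pastIndices, J] <;> omega
  let C (x : ℕ ⊕ ℕ → ℝ) : Prop := Connected (interarrival x) (service x) n ∧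
    n ∈ present (interarrival x) (service x) t
  have hC : MeasurableSet {x | C x} :=
    (measurableSet_connected (by fun_prop) (by fun_prop) n).inter
      (measurableSet_mem_present (by fun_prop) (by fun_prop) measurable_const n)
  let R (x y : ℕ ⊕ ℕ → ℝ) : Prop := C x ∧
    NonePresent (interarrival y) (service y) m (n + 1) (t - arrivalTime (interarrival x) n)
  have hR : MeasurableSet {p : (ℕ ⊕ ℕ → ℝ) × (ℕ ⊕ ℕ → ℝ) | R p.1 p.2} :=
    (hC.preimage measurable_fst).inter
      (measurableSet_nonePresent (by fun_prop) (by fun_prop) (by fun_prop) m (n + 1))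
  have hdec : Q {x | R x x} = ∫⁻ x, Q {y | R x y} ∂Q := by
    refine measure_decouple hQ.iIndepFun hIJ hR (fun y x x' h ↦ ?_) fun x y y' h ↦ ?_
    · have hT : arrivalTime (interarrival x) n = arrivalTime (interarrival x') n :=
        arrivalTime_congr fun i hi ↦ interarrival_eq_of_past h hi
      have hs : service x n = service x' n := service_eq_of_past h n.lt_succ_self
      have hc : Connected (interarrival x) (service x) n ↔
          Connected (interarrival x') (service x') n :=
        connected_congr (fun i hi ↦ interarrival_eq_of_past h hi)
          fun i hi ↦ service_eq_of_past h (hi.trans n.lt_succ_self)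
      simp only [R, C, present, mem_ofPred_eq, hT, hs, hc]
    · exact propext <| and_congr_right' <| nonePresent_congr
        (fun i hi hi' ↦ h (.inl i) (by simp [J]; omega))
        fun i hi hi' ↦ h (.inr i) (by simp [J]; omega)
  change ENNReal.ofReal (Real.exp (-(lam * α))) * Q {x | C x} ≤ Q {x | R x x}
  rw [hdec, ← lintegral_indicator_one hC,
    ← lintegral_const_mul _ (measurable_one.indicator hC)]
  refine lintegral_mono fun x ↦ ?_
  by_cases hx : C x
  · rw [indicator_of_mem (show x ∈ {x | C x} from hx), Pi.one_apply, mul_one]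
    have : {y | R x y} = {y | NonePresent (interarrival y) (service y) m (n + 1)
        (t - arrivalTime (interarrival x) n)} := by ext y; simp [R, hx]
    rw [this]
    exact (ENNReal.ofReal_le_ofReal (exp_neg_le_emptyProb hlam hα _)).trans
      (hQ.emptyProb_le hlam hα m (n + 1) (sub_nonneg.2 hx.2.1))
  · simp [hx]

lemma IsQueueLaw.le_measure_unfinished (hQ : IsQueueLaw Q lam α) (hlam : 0 < lam) (hα : 0 < α)
    {t : ℝ} (ht : 0 ≤ t) :
    ENNReal.ofReal (Real.exp (-(lam * t))) + ENNReal.ofReal (Real.exp (-(lam * α))) *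
        ∫⁻ u, ENNReal.ofReal lam * survival α t u *
          Q {x | Unfinished (interarrival x) (service x) u} ≤
      Q {x | Unfinished (interarrival x) (service x) t} := by
  rw [← hQ.tsum_lintegral_connected hlam hα (measurable_survival α t)
    fun u hu ↦ indicator_of_notMem (by simp [hu]) _]
  simp only [← hQ.measure_present hlam hα]
  rw [← hQ.measure_lt_interarrival hlam ht 0, ← ENNReal.tsum_mul_left,
    ENNReal.tsum_eq_iSup_nat, ENNReal.add_iSup]
  refine iSup_le fun M ↦ ?_
  -- The same M truncates the sum and sets the look-ahead: for n < M, customers n + 1, …, n + M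
  -- include every later index below M, so these events are almost surely disjoint.
  let D (n : ℕ) : Set (ℕ ⊕ ℕ → ℝ) := {x | (Connected (interarrival x) (service x) n ∧
    n ∈ present (interarrival x) (service x) t) ∧
      NonePresent (interarrival x) (service x) M (n + 1) (t - arrivalTime (interarrival x) n)}
  have hD (n : ℕ) : MeasurableSet (D n) :=
    ((measurableSet_connected (by fun_prop) (by fun_prop) n).inter
      (measurableSet_mem_present (by fun_prop) (by fun_prop) measurable_const n)).inter
      (measurableSet_nonePresent (by fun_prop) (by fun_prop) (by fun_prop) M (n + 1))
  have hpos := hQ.ae_pos hlam hα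
  have hdisj : (Finset.range M : Set ℕ).Pairwise (Function.onFun (AEDisjoint Q) D) := by
    have key {i j : ℕ} (hij : i < j) (hj : j < M) : AEDisjoint Q (D i) (D j) := by
      refine measure_mono_null (fun x hx ↦ ?_) (ae_iff.1 hpos)
      exact fun h ↦ NonePresent.notMem_present h.1 hij (by omega) hx.1.2 hx.2.1.2
    intro i hi j hj hij
    simp only [Finset.coe_range, mem_Iio] at hi hj
    rcases lt_or_gt_of_ne hij with h | h
    exacts [key h hj, (key h hi).symm]
  calc Q {x | t < interarrival x 0} + ∑ n ∈ Finset.range M, ENNReal.ofReal (Real.exp (-(lam * α))) *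
        Q {x | Connected (interarrival x) (service x) n ∧
          n ∈ present (interarrival x) (service x) t}
      ≤ Q {x | t < interarrival x 0} + ∑ n ∈ Finset.range M, Q (D n) := by
        gcongr with n
        exact hQ.le_measure_last_present hlam hα n M t
    _ = Q {x | t < interarrival x 0} + Q (⋃ n ∈ Finset.range M, D n) := by
        rw [measure_biUnion_finset₀ hdisj fun n _ ↦ (hD n).nullMeasurableSet]
    _ = Q ({x | t < interarrival x 0} ∪ ⋃ n ∈ Finset.range M, D n) := by
        rw [measure_union₀ (Finset.measurableSet_biUnion _ fun n _ ↦ hD n).nullMeasurableSet]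
        refine measure_mono_null (fun x hx ↦ ?_) (ae_iff.1 hpos)
        intro h
        obtain ⟨n, -, hn⟩ := mem_iUnion₂.1 hx.2
        have := (arrivalTime_strictMono h.1).monotone (Nat.zero_le n)
        rw [arrivalTime_zero] at this
        exact absurd (lt_of_lt_of_le hx.1 this) (not_lt.2 hn.1.2.1)
    _ ≤ _ := by
        refine measure_mono ?_
        rintro x (h | h)
        · exact Or.inl h
        · obtain ⟨n, -, hn⟩ := mem_iUnion₂.1 h
          exact Or.inr ⟨n, hn.1⟩

end Law

/-! ### Grönwall comparison and the explicit solution -/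

section Comparison

/-- A form of Grönwall's inequality. -/
lemma nonneg_of_mul_integral_le {E : ℝ → ℝ} {c M T : ℝ} (hc : 0 ≤ c)
    (hE : ∀ t ∈ Icc 0 T, IntervalIntegrable E volume 0 t) (hM : ∀ t ∈ Icc 0 T, -M ≤ E t)
    (h : ∀ t ∈ Icc 0 T, c * ∫ u in 0..t, E u ≤ E t) {t : ℝ} (ht : t ∈ Icc 0 T) : 0 ≤ E t := by
  -- Feeding a lower bound back into the hypothesis integrates it once more; the iterates tend to 0.
  have key (n : ℕ) : ∀ t ∈ Icc 0 T, -(M * ((c * t) ^ n / n.factorial)) ≤ E t := by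
    induction n with
    | zero => simpa using hM
    | succ n ih =>
      intro t ht
      refine le_trans ?_ (h t ht)
      have hcont : Continuous fun u : ℝ ↦ -(M * ((c * u) ^ n / n.factorial)) := by fun_prop
      have hmono : ∫ u in 0..t, -(M * ((c * u) ^ n / n.factorial)) ≤ ∫ u in 0..t, E u :=
        intervalIntegral.integral_mono_on ht.1 (hcont.intervalIntegrable _ _) (hE t ht)
          fun u hu ↦ ih u ⟨hu.1, hu.2.trans ht.2⟩
      refine le_trans (le_of_eq ?_) (mul_le_mul_of_nonneg_left hmono hc)
      have hint : ∫ u in 0..t, -(M * ((c * u) ^ n / n.factorial))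
          = -(M * c ^ n / n.factorial) * ∫ u in 0..t, u ^ n := by
        rw [← intervalIntegral.integral_const_mul]
        congr 1
        ext u
        rw [mul_pow]
        ring
      rw [hint, integral_pow, Nat.factorial_succ]
      have : (n.factorial : ℝ) ≠ 0 := by positivity
      push_cast
      field_simp
      ring
  have hlim : Tendsto (fun n : ℕ ↦ -(M * ((c * t) ^ n / n.factorial))) atTop (𝓝 0) := by
    simpa using ((FloorSemiring.tendsto_pow_div_factorial_atTop (c * t)).const_mul M).neg
  exact le_of_tendsto' hlim fun n ↦ key n t ht

/-- Multiplication by e^{κt} turns the exponential kernel into a constant one. -/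
lemma nonneg_of_integral_exp_le {d : ℝ → ℝ} {c κ M T : ℝ} (hc : 0 ≤ c) (hκ : 0 ≤ κ)
    (hT : 0 ≤ T) (hd : Measurable d) (hdM : ∀ t ∈ Icc 0 T, |d t| ≤ M)
    (h : ∀ t ∈ Icc 0 T, ∫ u in 0..t, c * Real.exp (-(κ * (t - u))) * d u ≤ d t) : 0 ≤ d T := by
  have hbound : ∀ t ∈ Icc 0 T, |Real.exp (κ * t) * d t| ≤ Real.exp (κ * T) * M := by
    intro t ht
    rw [abs_mul, Real.abs_exp]
    exact mul_le_mul (Real.exp_le_exp.2 (mul_le_mul_of_nonneg_left ht.2 hκ)) (hdM t ht)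
      (abs_nonneg _) (Real.exp_pos _).le
  have key := nonneg_of_mul_integral_le (E := fun t ↦ Real.exp (κ * t) * d t)
    (M := Real.exp (κ * T) * M) hc (T := T) (t := T) ?_ (fun t ht ↦ (abs_le.1 (hbound t ht)).1) ?_
    ⟨hT, le_rfl⟩
  · exact nonneg_of_mul_nonneg_right key (Real.exp_pos _)
  · intro t ht
    rw [intervalIntegrable_iff_integrableOn_Ioc_of_le ht.1]
    refine Measure.integrableOn_of_bounded (M := Real.exp (κ * T) * M) (by simp) (by fun_prop) ?_
    filter_upwards [ae_restrict_mem measurableSet_Ioc] with u hu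
    exact hbound u ⟨hu.1.le, hu.2.trans ht.2⟩
  · intro t ht
    refine le_trans (le_of_eq ?_) (mul_le_mul_of_nonneg_left (h t ht) (Real.exp_pos (κ * t)).le)
    rw [← intervalIntegral.integral_const_mul, ← intervalIntegral.integral_const_mul]
    congr 1
    ext u
    have : Real.exp (κ * u) = Real.exp (κ * t) * Real.exp (-(κ * (t - u))) := by
      rw [← Real.exp_add]; congr 1; ring
    rw [this]
    ring

end Comparison

/-- The solution of the linear integral equation `tailBound_eq`. -/
noncomputable def tailBound (lam α q t : ℝ) : ℝ :=
  ((lam * α - 1) * Real.exp (-(lam * t)) +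
    lam * α * q * Real.exp (-((1 - lam * α * q) / α * t))) / (lam * α * (1 + q) - 1)

@[fun_prop]
lemma continuous_tailBound (lam α q : ℝ) : Continuous (tailBound lam α q) := by
  unfold tailBound
  fun_prop

/-- The integrand is the derivative of e^{-(t-u)/α} (y(u) - e^{-λu}), where y is `tailBound`; this
vanishes at u = 0 because y(0) = 1. -/
lemma tailBound_eq {lam α q : ℝ} (hα : α ≠ 0) (hq : lam * α * (1 + q) - 1 ≠ 0) (t : ℝ) :
    tailBound lam α q t = Real.exp (-(lam * t)) +
      ∫ u in 0..t, lam * q * Real.exp (-(α⁻¹ * (t - u))) * tailBound lam α q u := by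
  have hsub (u : ℝ) : tailBound lam α q u - Real.exp (-(lam * u)) =
      lam * α * q * (Real.exp (-((1 - lam * α * q) / α * u)) - Real.exp (-(lam * u))) /
        (lam * α * (1 + q) - 1) := by
    rw [tailBound, div_sub' hq]
    ring
  have hexp (b u : ℝ) : HasDerivAt (fun u ↦ Real.exp (-(b * u))) (-(b * Real.exp (-(b * u)))) u := by
    convert! ((hasDerivAt_id u).const_mul b).neg.exp using 1
    simp
    ring
  have hderiv (u : ℝ) : HasDerivAt
      (fun u ↦ Real.exp (-(α⁻¹ * (t - u))) * (tailBound lam α q u - Real.exp (-(lam * u))))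
      (lam * q * Real.exp (-(α⁻¹ * (t - u))) * tailBound lam α q u) u := by
    have h1 : HasDerivAt (fun u ↦ Real.exp (-(α⁻¹ * (t - u))))
        (Real.exp (-(α⁻¹ * (t - u))) * -(α⁻¹ * -1)) u :=
      (((hasDerivAt_id u).const_sub t).const_mul α⁻¹).neg.exp
    have h2 := (((hexp ((1 - lam * α * q) / α) u).sub (hexp lam u)).const_mul
      (lam * α * q)).div_const (lam * α * (1 + q) - 1)
    simp only [hsub]
    convert! h1.mul h2 using 1
    simp only [Pi.sub_apply]
    rw [tailBound]
    field_simp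
    ring
  rw [intervalIntegral.integral_eq_sub_of_hasDerivAt (fun u _ ↦ hderiv u)
    (Continuous.intervalIntegrable (by fun_prop) _ _)]
  have h0 : tailBound lam α q 0 - Real.exp (-(lam * 0)) = 0 := by rw [hsub]; simp
  rw [h0]
  simp

/-! ### Bounds for the tail on path space -/

section Law

variable {Q : Measure (ℕ ⊕ ℕ → ℝ)} {lam α : ℝ}

/-- The tail of the distribution of the busy cycle. -/
noncomputable def tail (Q : Measure (ℕ ⊕ ℕ → ℝ)) (t : ℝ) : ℝ :=
  Q.real {x | Unfinished (interarrival x) (service x) t}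

lemma measurable_tail [IsProbabilityMeasure Q] : Measurable (tail Q) :=
  (measurable_measure_prodMk_left (s := {p : ℝ × (ℕ ⊕ ℕ → ℝ) |
    Unfinished (interarrival p.2) (service p.2) p.1})
    (measurableSet_unfinished (by fun_prop) (by fun_prop) measurable_fst)).ennreal_toReal

lemma abs_tail_le [IsProbabilityMeasure Q] (t : ℝ) : |tail Q t| ≤ 1 := by
  rw [tail, abs_of_nonneg measureReal_nonneg]
  exact measureReal_le_one

lemma intervalIntegrable_mul_tail [IsProbabilityMeasure Q] {f : ℝ → ℝ} (hf : Continuous f)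
    (t : ℝ) : IntervalIntegrable (fun u ↦ f u * tail Q u) volume 0 t := by
  refine IntervalIntegrable.continuousOn_mul ?_ hf.continuousOn
  rw [intervalIntegrable_iff]
  exact Measure.integrableOn_of_bounded (M := 1) (by simp) measurable_tail.aestronglyMeasurable
    (.of_forall abs_tail_le)

lemma lintegral_survival_mul [IsProbabilityMeasure Q] (hlam : 0 < lam) {t : ℝ} (ht : 0 ≤ t) :
    ∫⁻ u, ENNReal.ofReal lam * survival α t u *
        Q {x | Unfinished (interarrival x) (service x) u} =
      ENNReal.ofReal (∫ u in 0..t, lam * Real.exp (-(α⁻¹ * (t - u))) * tail Q u) := by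
  rw [← setLIntegral_Icc_ofReal ht (intervalIntegrable_mul_tail (by fun_prop) t),
    ← lintegral_indicator measurableSet_Icc]
  · refine lintegral_congr fun u ↦ ?_
    by_cases hu : u ∈ Icc 0 t
    · rw [survival, indicator_of_mem hu, indicator_of_mem hu, ENNReal.ofReal_mul (by positivity),
        ENNReal.ofReal_mul hlam.le, tail, ofReal_measureReal]
    · rw [survival, indicator_of_notMem hu, indicator_of_notMem hu, mul_zero, zero_mul]
  · exact fun u _ ↦ mul_nonneg (by positivity) measureReal_nonneg

lemma integral_mul_tail_nonneg (hlam : 0 < lam) {t : ℝ} (ht : 0 ≤ t) :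
    0 ≤ ∫ u in 0..t, lam * Real.exp (-(α⁻¹ * (t - u))) * tail Q u :=
  intervalIntegral.integral_nonneg ht fun _ _ ↦ mul_nonneg (by positivity) measureReal_nonneg

lemma IsQueueLaw.tail_le (hQ : IsQueueLaw Q lam α) (hlam : 0 < lam) (hα : 0 < α)
    {t : ℝ} (ht : 0 ≤ t) :
    tail Q t ≤ Real.exp (-(lam * t)) +
      ∫ u in 0..t, lam * Real.exp (-(α⁻¹ * (t - u))) * tail Q u := by
  have := hQ.indep.isProbabilityMeasure
  have h := hQ.measure_unfinished_le hlam hα ht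
  have h0 := integral_mul_tail_nonneg (Q := Q) (α := α) hlam ht
  rw [lintegral_survival_mul hlam ht, ← ENNReal.ofReal_add (Real.exp_pos _).le h0] at h
  exact ENNReal.toReal_le_of_le_ofReal (by positivity) h

lemma IsQueueLaw.le_tail (hQ : IsQueueLaw Q lam α) (hlam : 0 < lam) (hα : 0 < α)
    {t : ℝ} (ht : 0 ≤ t) :
    Real.exp (-(lam * t)) + Real.exp (-(lam * α)) *
      ∫ u in 0..t, lam * Real.exp (-(α⁻¹ * (t - u))) * tail Q u ≤ tail Q t := by
  have := hQ.indep.isProbabilityMeasure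
  have h := hQ.le_measure_unfinished hlam hα ht
  have h0 := integral_mul_tail_nonneg (Q := Q) (α := α) hlam ht
  rw [lintegral_survival_mul hlam ht, ← ENNReal.ofReal_mul (Real.exp_pos _).le,
    ← ENNReal.ofReal_add (Real.exp_pos _).le (by positivity)] at h
  exact (ENNReal.ofReal_le_iff_le_toReal (measure_ne_top _ _)).1 h

lemma exists_abs_tailBound_sub_tail_le [IsProbabilityMeasure Q] (lam α q T : ℝ) :
    ∃ M, ∀ t ∈ Icc 0 T, |tailBound lam α q t - tail Q t| ≤ M := by
  obtain ⟨M, hM⟩ := isCompact_Icc.exists_bound_of_continuousOn (s := Icc 0 T)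
    (continuous_tailBound lam α q).continuousOn
  refine ⟨|M| + 1, fun t ht ↦ (abs_sub _ _).trans ?_⟩
  exact add_le_add ((hM t ht).trans (le_abs_self M)) (abs_tail_le t)

lemma IsQueueLaw.tail_le_tailBound (hQ : IsQueueLaw Q lam α) (hlam : 0 < lam) (hα : 0 < α)
    (hq : lam * α * (1 + 1) - 1 ≠ 0) {T : ℝ} (hT : 0 ≤ T) : tail Q T ≤ tailBound lam α 1 T := by
  have := hQ.indep.isProbabilityMeasure
  obtain ⟨M, hM⟩ := exists_abs_tailBound_sub_tail_le (Q := Q) lam α 1 T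
  refine sub_nonneg.1 (nonneg_of_integral_exp_le (d := fun t ↦ tailBound lam α 1 t - tail Q t)
    hlam.le (inv_pos.2 hα).le hT ?_ hM fun t ht ↦ ?_)
  · exact (continuous_tailBound lam α 1).measurable.sub measurable_tail
  · have h := hQ.tail_le hlam hα ht.1
    have hy := tailBound_eq hα.ne' hq t
    simp only [mul_sub, mul_one] at h hy ⊢
    rw [intervalIntegral.integral_sub (Continuous.intervalIntegrable (by fun_prop) _ _)
      (intervalIntegrable_mul_tail (by fun_prop) t)]
    linarith

lemma IsQueueLaw.tailBound_le_tail (hQ : IsQueueLaw Q lam α) (hlam : 0 < lam) (hα : 0 < α)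
    (hq : lam * α * (1 + Real.exp (-(lam * α))) - 1 ≠ 0) {T : ℝ} (hT : 0 ≤ T) :
    tailBound lam α (Real.exp (-(lam * α))) T ≤ tail Q T := by
  have := hQ.indep.isProbabilityMeasure
  obtain ⟨M, hM⟩ := exists_abs_tailBound_sub_tail_le (Q := Q) lam α (Real.exp (-(lam * α))) T
  refine sub_nonneg.1 (nonneg_of_integral_exp_le (c := lam * Real.exp (-(lam * α)))
    (d := fun t ↦ tail Q t - tailBound lam α (Real.exp (-(lam * α))) t) (by positivity)
    (inv_pos.2 hα).le hT ?_ (fun t ht ↦ by rw [abs_sub_comm]; exact hM t ht) fun t ht ↦ ?_)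
  · exact measurable_tail.sub (continuous_tailBound _ _ _).measurable
  · have h := hQ.le_tail hlam hα ht.1
    have hy := tailBound_eq hα.ne' hq t
    simp only [mul_sub]
    rw [intervalIntegral.integral_sub (intervalIntegrable_mul_tail (by fun_prop) t)
      (Continuous.intervalIntegrable (by fun_prop) _ _)]
    rw [← intervalIntegral.integral_const_mul] at h
    have hcomm : ∫ u in 0..t, lam * Real.exp (-(lam * α)) * Real.exp (-(α⁻¹ * (t - u))) * tail Q u
        = ∫ u in 0..t, Real.exp (-(lam * α)) *
          (lam * Real.exp (-(α⁻¹ * (t - u))) * tail Q u) := by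
      congr 1
      ext u
      ring
    simp only [mul_sub] at h hy hcomm
    linarith

end Law

/-! ### Transfer to an arbitrary probability space -/

lemma IsQueue.isQueueLaw_map {Ω : Type*} [MeasurableSpace Ω] {P : Measure Ω} {lam α : ℝ}
    {A S : ℕ → Ω → ℝ} (h : IsQueue P lam α A S) :
    AEMeasurable (fun ω i ↦ Sum.elim A S i ω) P ∧
      IsQueueLaw (P.map fun ω i ↦ Sum.elim A S i ω) lam α := by
  have := h.indep.isProbabilityMeasure
  have hm : AEMeasurable (fun ω i ↦ Sum.elim A S i ω) P := by
    refine aemeasurable_pi_iff.2 ?_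
    rintro (i | i)
    exacts [(h.hasLaw_interarrival i).aemeasurable, (h.hasLaw_service i).aemeasurable]
  have hmap (i : ℕ ⊕ ℕ) : (P.map fun ω i ↦ Sum.elim A S i ω).map (fun x ↦ x i)
      = P.map (Sum.elim A S i) :=
    AEMeasurable.map_map_of_aemeasurable (measurable_pi_apply i).aemeasurable hm
  have : IsProbabilityMeasure (P.map fun ω i ↦ Sum.elim A S i ω) :=
    Measure.isProbabilityMeasure_map hm
  refine ⟨hm, ⟨fun n ↦ ⟨by fun_prop, ?_⟩, fun n ↦ ⟨by fun_prop, ?_⟩, ?_⟩⟩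
  · exact (hmap (.inl n)).trans (h.hasLaw_interarrival n).map_eq
  · exact (hmap (.inr n)).trans (h.hasLaw_service n).map_eq
  · have hi : iIndepFun (fun i (x : ℕ ⊕ ℕ → ℝ) ↦ x i) (P.map fun ω i ↦ Sum.elim A S i ω) := by
      -- Both independence statements say that the joint law is the product of its marginals, and
      -- the coordinates under the pushforward have the same joint law.
      rw [iIndepFun_iff_map_fun_eq_infinitePi_map fun i ↦ measurable_pi_apply i]
      simp only [hmap]
      rw [← (iIndepFun_iff_map_fun_eq_infinitePi_map₀ hm).1 h.indep]
      exact Measure.map_id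
    convert hi using 2 with i
    cases i <;> rfl

lemma IsQueue.measureReal_busyCycle_le {Ω : Type*} [MeasurableSpace Ω] {P : Measure Ω} {lam α : ℝ}
    {A S : ℕ → Ω → ℝ} (h : IsQueue P lam α A S) (hlam : 0 < lam) (hα : 0 < α) (t : ℝ) :
    P.real {ω | busyCycle (fun n ↦ A n ω) (fun n ↦ S n ω) ≤ (t : EReal)} =
      1 - tail (P.map fun ω i ↦ Sum.elim A S i ω) t := by
  obtain ⟨hm, hQ⟩ := h.isQueueLaw_map
  have := hQ.indep.isProbabilityMeasure
  have hU : MeasurableSet {x | Unfinished (interarrival x) (service x) t} :=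
    measurableSet_unfinished (by fun_prop) (by fun_prop) measurable_const
  rw [tail, ← probReal_compl_eq_one_sub hU, map_measureReal_apply_of_aemeasurable hm hU.compl]
  refine measureReal_congr ?_
  filter_upwards [ae_of_ae_map hm (hQ.ae_pos hlam hα)] with ω hω
  exact propext (busyCycle_le_iff hω.1 (hω.2 0))

end MMInfQueue

theorem mainTheorem3 {Ω : Type*} [MeasurableSpace Ω] (P : Measure Ω) [IsProbabilityMeasure P]
    (lam α ρ : ℝ) (hlam : 0 < lam) (hα : 0 < α) (hρ : ρ = lam * α)
    (A S : ℕ → Ω → ℝ) (hQ : MMInfQueue.IsQueue P lam α A S) (t : ℝ) (ht : 0 ≤ t) :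
    (2 * ρ - 1 ≠ 0 →
      1 - ((ρ - 1) * Real.exp (-lam * t) + ρ * Real.exp (-((1 - ρ) / α * t))) / (2 * ρ - 1)
        ≤ P.real {ω | MMInfQueue.busyCycle (fun n => A n ω) (fun n => S n ω) ≤ (t : EReal)}) ∧
    (ρ * (1 + Real.exp (-ρ)) - 1 ≠ 0 →
      P.real {ω | MMInfQueue.busyCycle (fun n => A n ω) (fun n => S n ω) ≤ (t : EReal)}
        ≤ 1 - ((ρ - 1) * Real.exp (-lam * t)
              + ρ * Real.exp (-ρ - (1 - ρ * Real.exp (-ρ)) / α * t))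
            / (ρ * (1 + Real.exp (-ρ)) - 1)) := by
  subst hρ
  rw [hQ.measureReal_busyCycle_le hlam hα t]
  have hlaw := hQ.isQueueLaw_map.2
  constructor
  · intro h
    have hq : lam * α * (1 + 1) - 1 ≠ 0 := by convert! h using 1; ring
    have := hlaw.tail_le_tailBound hlam hα hq ht
    rw [MMInfQueue.tailBound] at this
    convert sub_le_sub_left this 1 using 3
    · rw [neg_mul, mul_one]
    · ring
  · intro h
    have := hlaw.tailBound_le_tail hlam hα h ht
    rw [MMInfQueue.tailBound] at this
    -- Splitting e^{-ρ-x} as e^{-ρ} e^{-x} exhibits the factor q = e^{-ρ} of `tailBound`.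
    rw [neg_mul, sub_eq_add_neg (-(lam * α)), Real.exp_add, ← mul_assoc]
    exact sub_le_sub_left this 1
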